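/- Let $A=(a_{ij})_{i,j\in I}$ be a symmetrizable generalized Cartan matrix with $I$ finite, with weight lattice $P$, linearly independent simple roots $\alpha_i\in P$ and linearly independent simple coroots $\alpha_i^\vee\in\mathrm{Hom}(P,\mathbb Z)$ satisfying $\langle\alpha_i^\vee,\alpha_j\rangle=a_{ij}$. For $i\in I$ let $B_i=\{(x)_i : x\in\mathbb Z\}$ be the elementary crystal with $wt(x)_i=x\alpha_i$, $\varepsilon_i(x)_i=-x$, $\varphi_i(x)_i=x$, $\tilde e_i(x)_i=(x+1)_i$, $\tilde f_i(x)_i=(x-1)_i$, and $\varepsilon_j(x)_i=\varphi_j(x)_i=-\infty$, $\tilde e_j(x)_i=\tilde f_j(x)_i=0$ for $j\neq i$. Tensor products of crystals are taken in Kashiwara's convention, so that $\tilde e_i(b\otimes b')=\tilde e_i b\otimes b'$ if $\varphi_i(b)\ge\varepsilon_i(b')$ and $\tilde e_i(b\otimes b')=b\otimes\tilde e_i b'$ otherwise, and $\tilde e_i 0=0$, $0\otimes b=b\otimes 0=0$. Corollary 5.8. Let $k\ge 1$ and let $i_1,\dots,i_k\in I$ be arbitrary. Then for all $i,j\in I$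 and all integers $c_1,c_2\ge 0$, the following identities of maps hold on $(B_{i_1}\otimes\cdots\otimes B_{i_k})\sqcup\{0\}$: 1. if $\langle\alpha_i^\vee,\alpha_j\rangle=0$, then $$\tilde e_i^{\,c_1}\tilde e_j^{\,c_2}=\tilde e_j^{\,c_2}\tilde e_i^{\,c_1};$$ 2. if $\langle\alpha_i^\vee,\alpha_j\rangle=\langle\alpha_j^\vee,\alpha_i\rangle=-1$, then $$\tilde e_i^{\,c_1}\tilde e_j^{\,c_1+c_2}\tilde e_i^{\,c_2}=\tilde e_j^{\,c_2}\tilde e_i^{\,c_1+c_2}\tilde e_j^{\,c_1};$$ 3. if $\langle\alpha_i^\vee,\alpha_j\rangle=-1$ and $\langle\alpha_j^\vee,\alpha_i\rangle=-2$, then $$\tilde e_i^{\,c_1}\tilde e_j^{\,2c_1+c_2}\tilde e_i^{\,c_1+c_2}\tilde e_j^{\,c_2}=\tilde e_j^{\,c_2}\tilde e_i^{\,c_1+c_2}\tilde e_j^{\,2c_1+c_2}\tilde e_i^{\,c_1};$$ 4. if $\langle\alpha_i^\vee,\alpha_j\rangle=-1$ and $\langle\alpha_j^\vee,\alpha_i\rangle=-3$,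 then $$\tilde e_i^{\,c_1}\tilde e_j^{\,3c_1+c_2}\tilde e_i^{\,2c_1+c_2}\tilde e_j^{\,3c_1+2c_2}\tilde e_i^{\,c_1+c_2}\tilde e_j^{\,c_2}=\tilde e_j^{\,c_2}\tilde e_i^{\,c_1+c_2}\tilde e_j^{\,3c_1+2c_2}\tilde e_i^{\,2c_1+c_2}\tilde e_j^{\,3c_1+c_2}\tilde e_i^{\,c_1}.$$ -/

import Mathlib

/-- A symmetrizable generalized Cartan matrix `A` together with root data: a weight lattice `P`
(any abelian group), linearly independent simple roots `α j ∈ P` and linearly independent simple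
coroots `α^∨ i ∈ Hom(P, ℤ)` with `⟨α^∨ i, α j⟩ = A i j`. -/
structure CartanDatum (I P : Type*) [AddCommGroup P] where
  A : Matrix I I ℤ
  diag : ∀ i, A i i = 2
  nonpos : ∀ i j, i ≠ j → A i j ≤ 0
  zero_iff : ∀ i j, A i j = 0 ↔ A j i = 0
  symmetrizable : ∃ d : I → ℤ, (∀ i, 0 < d i) ∧ ∀ i j, d i * A i j = d j * A j i
  root : I → P
  coroot : I → Module.Dual ℤ P
  linearIndependent_root : LinearIndependent ℤ root
  linearIndependent_coroot : LinearIndependent ℤ coroot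
  coroot_root : ∀ i j, coroot i (root j) = A i j

/-- A (Kashiwara) crystal. The value `0` of a Kashiwara operator `ẽ_i`, `f̃_i` is `none`, and
`⊥ : WithBot ℤ` is `-∞`. (The rules for `wt`, `ε`, `φ` under `f̃_i` follow from those under `ẽ_i`
and `e_eq_iff`.) -/
structure Crystal {I P : Type*} [AddCommGroup P] (D : CartanDatum I P) where
  carrier : Type
  wt : carrier → P
  ε : I → carrier → WithBot ℤ
  φ : I → carrier → WithBot ℤ
  e : I → carrier → Option carrier
  f : I → carrier → Option carrier
  φ_eq : ∀ i b, φ i b = ε i b + ((D.coroot i (wt b) : ℤ) : WithBot ℤ)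
  wt_e : ∀ i b b', e i b = some b' → wt b' = wt b + D.root i
  ε_e : ∀ i b b', e i b = some b' → ε i b' + 1 = ε i b
  φ_e : ∀ i b b', e i b = some b' → φ i b' = φ i b + 1
  e_eq_iff : ∀ i b b', e i b = some b' ↔ f i b' = some b
  e_eq_none : ∀ i b, φ i b = ⊥ → e i b = none
  f_eq_none : ∀ i b, φ i b = ⊥ → f i b = none

namespace Crystal

variable {I P : Type*} [AddCommGroup P] {D : CartanDatum I P}

/-- The elementary crystal `B_i = {(x)_i | x ∈ ℤ}`. -/
noncomputable def elementary [DecidableEq I] (D : CartanDatum I P) (i : I) : Crystal D where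
  carrier := ℤ
  wt x := x • D.root i
  ε j x := if j = i then ((-x : ℤ) : WithBot ℤ) else ⊥
  φ j x := if j = i then (x : WithBot ℤ) else ⊥
  e j x := if j = i then some (x + 1) else none
  f j x := if j = i then some (x - 1) else none
  φ_eq j x := by
    by_cases h : j = i
    · subst h
      simp only [if_true, map_zsmul, D.coroot_root, D.diag]
      rw [← WithBot.coe_add]
      congr 1
      simp only [smul_eq_mul]
      ring
    · simp [h]
  wt_e j x x' h := by
    by_cases hj : j = i
    · subst hj
      simp only [if_true, Option.some.injEq] at h
      rw [← h, add_smul, one_smul]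
    · simp [hj] at h
  ε_e j x x' h := by
    by_cases hj : j = i
    · simp only [hj, if_true, Option.some.injEq] at h ⊢
      rw [← h, ← WithBot.coe_one, ← WithBot.coe_add]
      congr 1
      ring
    · simp [hj] at h
  φ_e j x x' h := by
    by_cases hj : j = i
    · simp only [hj, if_true, Option.some.injEq] at h ⊢
      rw [← h, ← WithBot.coe_one, ← WithBot.coe_add]
    · simp [hj] at h
  e_eq_iff j x x' := by
    by_cases hj : j = i
    · simp only [hj, if_true, Option.some.injEq]
      omega
    · simp [hj]
  e_eq_none j x h := by
    by_cases hj : j = i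
    · simp [hj] at h
    · simp [hj]
  f_eq_none j x h := by
    by_cases hj : j = i
    · simp [hj] at h
    · simp [hj]

theorem lt_add_one_aux {x : WithBot ℤ} (h : x ≠ ⊥) : x < x + 1 := by
  induction x using WithBot.recBotCoe with
  | bot => exact absurd rfl h
  | coe a =>
    rw [← WithBot.coe_one, ← WithBot.coe_add, WithBot.coe_lt_coe]
    omega

theorem add_one_le_aux {x y : WithBot ℤ} (h : x < y) : x + 1 ≤ y := by
  induction x using WithBot.recBotCoe with
  | bot => simp
  | coe a =>
    induction y using WithBot.recBotCoe with
    | bot => simp at h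
    | coe b =>
      rw [WithBot.coe_lt_coe] at h
      rw [← WithBot.coe_one, ← WithBot.coe_add, WithBot.coe_le_coe]
      omega

theorem le_of_lt_add_one_aux {x y : WithBot ℤ} (h : x < y + 1) : x ≤ y := by
  by_contra hc
  exact absurd h (not_lt.2 (add_one_le_aux (not_le.1 hc)))

/-- The tensor product `B₁ ⊗ B₂` of crystals (Kashiwara's convention); `0 ⊗ b = b ⊗ 0 = 0`. -/
noncomputable def tensor (B₁ B₂ : Crystal D) : Crystal D where
  carrier := B₁.carrier × B₂.carrier
  wt b := B₁.wt b.1 + B₂.wt b.2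
  ε i b := max (B₁.ε i b.1) (B₂.ε i b.2 + ((-D.coroot i (B₁.wt b.1) : ℤ) : WithBot ℤ))
  φ i b := max (B₂.φ i b.2) (B₁.φ i b.1 + ((D.coroot i (B₂.wt b.2) : ℤ) : WithBot ℤ))
  e i b := if B₂.ε i b.2 ≤ B₁.φ i b.1 then (B₁.e i b.1).map (fun x => (x, b.2))
    else (B₂.e i b.2).map (fun y => (b.1, y))
  f i b := if B₂.ε i b.2 < B₁.φ i b.1 then (B₁.f i b.1).map (fun x => (x, b.2))
    else (B₂.f i b.2).map (fun y => (b.1, y))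
  φ_eq i b := by
    rw [B₁.φ_eq, B₂.φ_eq]
    generalize B₁.ε i b.1 = x
    generalize B₂.ε i b.2 = y
    rw [map_add]
    generalize D.coroot i (B₁.wt b.1) = p
    generalize D.coroot i (B₂.wt b.2) = q
    induction x using WithBot.recBotCoe <;> induction y using WithBot.recBotCoe <;>
      simp only [WithBot.bot_add, ← WithBot.coe_add, ← WithBot.coe_max, bot_sup_eq, sup_bot_eq,
        WithBot.coe_inj] <;> omega
  wt_e i b b' h := by
    split_ifs at h with hc
    · obtain ⟨x, hx, rfl⟩ := Option.map_eq_some_iff.1 h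
      simp only [B₁.wt_e i _ _ hx]
      abel
    · obtain ⟨y, hy, rfl⟩ := Option.map_eq_some_iff.1 h
      simp only [B₂.wt_e i _ _ hy]
      abel
  ε_e i b b' h := by
    split_ifs at h with hc
    · obtain ⟨x, hx, rfl⟩ := Option.map_eq_some_iff.1 h
      have h0 := B₁.ε_e i _ _ hx
      rw [B₁.φ_eq] at hc
      simp only [B₁.wt_e i _ _ hx, map_add, D.coroot_root, D.diag, ← h0] at hc ⊢
      have hne : B₁.ε i x ≠ ⊥ := fun hb => by
        have : B₁.φ i b.1 = ⊥ := by rw [B₁.φ_eq, ← h0, hb]; simp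
        simp [B₁.e_eq_none i _ this] at hx
      revert hc hne
      generalize B₁.ε i x = s
      generalize B₂.ε i b.2 = t
      generalize D.coroot i (B₁.wt b.1) = p
      intro hc hne
      induction s using WithBot.recBotCoe <;> induction t using WithBot.recBotCoe <;>
        simp only [ne_eq, not_true_eq_false, WithBot.bot_add, ← WithBot.coe_one, ← WithBot.coe_add,
          ← WithBot.coe_max, bot_sup_eq, sup_bot_eq, WithBot.coe_inj, WithBot.coe_le_coe] at * <;>
        omega
    · obtain ⟨y, hy, rfl⟩ := Option.map_eq_some_iff.1 h
      have h0 := B₂.ε_e i _ _ hy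
      rw [B₁.φ_eq] at hc
      simp only [← h0] at hc ⊢
      revert hc
      generalize B₁.ε i b.1 = s
      generalize B₂.ε i y = t
      generalize D.coroot i (B₁.wt b.1) = p
      intro hc
      induction s using WithBot.recBotCoe <;> induction t using WithBot.recBotCoe <;>
        simp only [WithBot.bot_add, ← WithBot.coe_one, ← WithBot.coe_add, le_refl, not_true_eq_false,
          bot_le, ← WithBot.coe_max, bot_sup_eq, sup_bot_eq, WithBot.coe_inj,
          WithBot.coe_le_coe] at * <;>
        omega
  φ_e i b b' h := by
    split_ifs at h with hc
    · obtain ⟨x, hx, rfl⟩ := Option.map_eq_some_iff.1 h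
      have hne : B₁.φ i b.1 ≠ ⊥ := fun hb => by simp [B₁.e_eq_none i _ hb] at hx
      simp only [B₁.φ_e i _ _ hx, B₂.φ_eq]
      revert hc hne
      generalize B₁.φ i b.1 = s
      generalize B₂.ε i b.2 = t
      generalize D.coroot i (B₂.wt b.2) = p
      intro hc hne
      induction s using WithBot.recBotCoe <;> induction t using WithBot.recBotCoe <;>
        simp only [ne_eq, not_true_eq_false, WithBot.bot_add, ← WithBot.coe_one, ← WithBot.coe_add,
          ← WithBot.coe_max, bot_sup_eq, sup_bot_eq, WithBot.coe_inj, WithBot.coe_le_coe] at * <;>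
        omega
    · obtain ⟨y, hy, rfl⟩ := Option.map_eq_some_iff.1 h
      have hne : B₂.φ i b.2 ≠ ⊥ := fun hb => by simp [B₂.e_eq_none i _ hb] at hy
      simp only [B₂.φ_e i _ _ hy, B₂.wt_e i _ _ hy, map_add, D.coroot_root, D.diag]
      rw [B₂.φ_eq] at hne ⊢
      revert hc hne
      generalize B₁.φ i b.1 = s
      generalize B₂.ε i b.2 = t
      generalize D.coroot i (B₂.wt b.2) = p
      intro hc hne
      induction s using WithBot.recBotCoe <;> induction t using WithBot.recBotCoe <;>
        simp only [ne_eq, not_true_eq_false, WithBot.bot_add, ← WithBot.coe_one, ← WithBot.coe_add,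
          ← WithBot.coe_max, bot_sup_eq, sup_bot_eq, WithBot.coe_inj, WithBot.coe_le_coe] at * <;>
        omega
  e_eq_iff i b b' := by
    obtain ⟨b₁, b₂⟩ := b
    obtain ⟨b₁', b₂'⟩ := b'
    constructor
    · intro h
      split_ifs at h with hc
      · obtain ⟨x, hx, hxb⟩ := Option.map_eq_some_iff.1 h
        obtain ⟨rfl, rfl⟩ := Prod.mk.inj hxb
        have h1 := B₁.φ_e i _ _ hx
        have h2 : B₁.φ i b₁ ≠ ⊥ := fun h0 => by simp [B₁.e_eq_none i _ h0] at hx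
        have h3 : B₂.ε i b₂ < B₁.φ i x := by
          rw [h1]
          exact lt_of_le_of_lt hc (lt_add_one_aux h2)
        simp [h3, (B₁.e_eq_iff i _ _).1 hx]
      · obtain ⟨y, hy, hyb⟩ := Option.map_eq_some_iff.1 h
        obtain ⟨rfl, rfl⟩ := Prod.mk.inj hyb
        have h1 := B₂.ε_e i _ _ hy
        have h3 : ¬ B₂.ε i y < B₁.φ i b₁ := by
          rw [← h1] at hc
          exact fun hlt => hc (add_one_le_aux hlt)
        simp [h3, (B₂.e_eq_iff i _ _).1 hy]
    · intro h
      split_ifs at h with hc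
      · obtain ⟨x, hx, hxb⟩ := Option.map_eq_some_iff.1 h
        obtain ⟨rfl, rfl⟩ := Prod.mk.inj hxb
        have hx' := (B₁.e_eq_iff i _ _).2 hx
        have h1 := B₁.φ_e i _ _ hx'
        have h3 : B₂.ε i b₂' ≤ B₁.φ i x := by
          rw [h1] at hc
          exact le_of_lt_add_one_aux hc
        simp [h3, hx']
      · obtain ⟨y, hy, hyb⟩ := Option.map_eq_some_iff.1 h
        obtain ⟨rfl, rfl⟩ := Prod.mk.inj hyb
        have hy' := (B₂.e_eq_iff i _ _).2 hy
        have h1 := B₂.ε_e i _ _ hy'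
        have h2 : B₂.ε i b₂' ≠ ⊥ := fun h0 => by
          have : B₂.φ i b₂' = ⊥ := by rw [B₂.φ_eq, h0, WithBot.bot_add]
          simp [B₂.f_eq_none i _ this] at hy
        have h3 : ¬ B₂.ε i y ≤ B₁.φ i b₁' := by
          rw [← h1]
          exact not_le.2 (lt_of_le_of_lt (not_lt.1 hc) (lt_add_one_aux h2))
        simp [h3, hy']
  e_eq_none i b h := by
    obtain ⟨h2, h1⟩ := max_eq_bot.1 h
    have h1' : B₁.φ i b.1 = ⊥ := by simpa [WithBot.add_eq_bot] using h1
    simp [B₁.e_eq_none i _ h1', B₂.e_eq_none i _ h2]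
  f_eq_none i b h := by
    obtain ⟨h2, h1⟩ := max_eq_bot.1 h
    have h1' : B₁.φ i b.1 = ⊥ := by simpa [WithBot.add_eq_bot] using h1
    simp [B₁.f_eq_none i _ h1', B₂.f_eq_none i _ h2]

/-- The tensor product `B_{i₁} ⊗ B_{i₂} ⊗ ⋯ ⊗ B_{i_k}` for the nonempty word `i₁ :: [i₂, …, i_k]`. -/
noncomputable def elementaryTensor [DecidableEq I] (D : CartanDatum I P) : I → List I → Crystal D
  | i, [] => elementary D i
  | i, j :: w => tensor (elementary D i) (elementaryTensor D j w)

/-- `ẽ_i^c` as a self-map of `B ⊔ {0}`, where `ẽ_i 0 = 0`. -/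
def ePow (B : Crystal D) (i : I) (c : ℕ) : Option B.carrier → Option B.carrier :=
  (fun x => x.bind (B.e i))^[c]

end Crystal

/-! An element of `B_{i₁} ⊗ ⋯ ⊗ B_{i_k}` is a word of pairs (letter, integer). On such words `ẽ_t^c`
tropicalizes (sum becomes `max`, product becomes `+`) left multiplication by a one-parameter
unipotent element x_t(A) on a product of rank-one factors. Here `sat t A` is the tropical x_t(A),
and `raise t c` chooses the parameter A = c - ε_t that raises exactly c times.

Simply laced case: `sat_braid` is the tropical form of x_t(A) x_u(B) x_t(C) = x_u(BC/(A+C)) x_t(A+C)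
x_u(AB/(A+C)). It remains to see that the new parameters are those chosen by `raise` for the
exponents on the other side. This requires knowing how ε changes under the neighbouring operator;
the second-order quantities `mixed` record it, and they are tied to ε by the tropical Plücker
relation `eps_add_eps`. The result is `raise_braid`.

Types B₂ and G₂: node i is unfolded into two or three mutually orthogonal copies, each joined to j
by a simple edge, giving A₃ or D₄ with j at the centre. Each letter i becomes a block of copies with
the same integer, `ẽ_i^c` becomes the product of the `ẽ^c` of the copies, and the required relation
becomes an equality between two reduced words of the longest element, reached by commutations and
simply laced braid moves. -/

namespace LetterWord

/-! ### Tropical unipotent operators, their braid relation, and tropical Plücker coordinates. -/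

variable {L : Type*} [DecidableEq L] (a : L → L → ℤ)

/-- The tropical unipotent operator `x_t(A)`: apply `ẽ_t` until `ε_t ≤ -A`. -/
def sat (t : L) : ℤ → List (L × ℤ) → List (L × ℤ)
  | _, [] => []
  | A, (l, x) :: s =>
    if l = t then (l, max x A) :: sat t (A - x - max x A) s
    else (l, x) :: sat t (A - a t l * x) s

/-- The function `ε_t`. -/
def eps (t : L) : List (L × ℤ) → WithBot ℤ
  | [] => ⊥
  | (l, x) :: s =>
    if l = t then max ((-x : ℤ) : WithBot ℤ) (eps t s + ((-(2 * x) : ℤ) : WithBot ℤ))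
    else eps t s + ((-(a t l * x) : ℤ) : WithBot ℤ)

/-- The second-order analogue of `ε_t` (a ratio of tropical Plücker coordinates) attached to two
adjacent nodes `t`, `u`. -/
def mixed (t u : L) : List (L × ℤ) → WithBot ℤ
  | [] => ⊥
  | (l, x) :: s =>
    if l = u then max (mixed t u s + ((-((a t l + a u l) * x) : ℤ) : WithBot ℤ)) (eps a t s)
    else mixed t u s + ((-((a t l + a u l) * x) : ℤ) : WithBot ℤ)

variable {a}

theorem map_fst_sat (t : L) (A : ℤ) (s : List (L × ℤ)) :
    (sat a t A s).map Prod.fst = s.map Prod.fst := by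
  induction s generalizing A with
  | nil => rfl
  | cons p s ih =>
    obtain ⟨l, x⟩ := p
    by_cases h : l = t <;> simp [sat, h, ih]

theorem eps_ne_bot {t : L} {s : List (L × ℤ)} (h : t ∈ s.map Prod.fst) : eps a t s ≠ ⊥ := by
  induction s with
  | nil => simp at h
  | cons p s ih =>
    obtain ⟨l, x⟩ := p
    by_cases hl : l = t
    · simp [eps, hl]
    · have : t ∈ s.map Prod.fst := by
        rw [List.map_cons, List.mem_cons] at h
        exact h.resolve_left fun h => hl h.symm
      simpa [eps, hl] using ih this

theorem eps_eq_bot {t : L} {s : List (L × ℤ)} (h : t ∉ s.map Prod.fst) : eps a t s = ⊥ := by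
  induction s with
  | nil => rfl
  | cons p s ih =>
    obtain ⟨l, x⟩ := p
    rw [List.map_cons, List.mem_cons, not_or] at h
    simp [eps, Ne.symm h.1, ih h.2]

theorem sat_sat_self (t : L) (A B : ℤ) (s : List (L × ℤ)) :
    sat a t A (sat a t B s) = sat a t (max A B) s := by
  induction s generalizing A B with
  | nil => rfl
  | cons p s ih =>
    obtain ⟨l, x⟩ := p
    by_cases h : l = t
    · simp only [sat, h, if_true, ih]
      congr 2 <;> omega
    · simp only [sat, h, if_false, ih]
      congr 2
      omega

theorem sat_comm {t u : L} (htu : t ≠ u) (h₁ : a t u = 0) (h₂ : a u t = 0) (A B : ℤ)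
    (s : List (L × ℤ)) : sat a t A (sat a u B s) = sat a u B (sat a t A s) := by
  induction s generalizing A B with
  | nil => rfl
  | cons p s ih =>
    obtain ⟨l, x⟩ := p
    by_cases h : l = t
    · subst h
      simp [sat, htu, h₂, ih]
    · by_cases h' : l = u
      · subst h'
        simp [sat, htu.symm, h₁, ih]
      · simp [sat, h, h', ih]

/-- The induction must leave all three parameters free: each letter passed changes them, by a
substitution compatible with the change of coordinates (A, B, C) ↦ (B + C - max A C, max A C, A + B
- max A C). -/
theorem sat_braid {t u : L} (htu : t ≠ u) (h₁ : a t u = -1) (h₂ : a u t = -1) (A B C : ℤ)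
    (s : List (L × ℤ)) :
    sat a t A (sat a u B (sat a t C s)) =
      sat a u (B + C - max A C) (sat a t (max A C) (sat a u (A + B - max A C) s)) := by
  induction s generalizing A B C with
  | nil => rfl
  | cons p s ih =>
    obtain ⟨l, x⟩ := p
    by_cases h : l = t
    · subst h
      simp only [sat, htu, if_true, if_false, ih, h₂]
      congr 2
      · omega
      · omega
      · congr 1
        · omega
        · congr 1
          omega
    · by_cases h' : l = u
      · subst h'
        simp only [sat, htu.symm, if_true, if_false, ih, h₁]
        congr 2
        · omega
        · omega
        · congr 1
          · omega
          · congr 1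
            omega
      · simp only [sat, h, h', if_false, ih]
        congr 2
        · omega
        · congr 1
          · omega
          · congr 1
            omega

/-- Tropical form of ε ↦ ε / (1 + Aε). -/
theorem eps_sat_self (t : L) (A : ℤ) (s : List (L × ℤ)) :
    eps a t (sat a t A s) = min (eps a t s) ((-A : ℤ) : WithBot ℤ) := by
  induction s generalizing A with
  | nil => simp [sat, eps]
  | cons p s ih =>
    obtain ⟨l, x⟩ := p
    by_cases h : l = t
    · simp only [sat, eps, h, if_true, ih]
      generalize eps a t s = e
      induction e using WithBot.recBotCoe <;>
        simp only [WithBot.bot_add, bot_inf_eq, sup_bot_eq, ← WithBot.coe_add, ← WithBot.coe_max,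
          ← WithBot.coe_min, WithBot.coe_inj] <;> omega
    · simp only [sat, eps, h, if_false, ih]
      generalize eps a t s = e
      induction e using WithBot.recBotCoe <;>
        simp only [WithBot.bot_add, bot_inf_eq, ← WithBot.coe_add, ← WithBot.coe_min,
          WithBot.coe_inj]
      omega

theorem sat_eq_self {t : L} {A : ℤ} {s : List (L × ℤ)}
    (hA : eps a t s ≤ ((-A : ℤ) : WithBot ℤ)) : sat a t A s = s := by
  induction s generalizing A with
  | nil => rfl
  | cons p s ih =>
    obtain ⟨l, x⟩ := p
    by_cases h : l = t
    · simp only [eps, h, if_true, max_le_iff, WithBot.coe_le_coe] at hA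
      have hx : max x A = x := by omega
      simp only [sat, h, if_true, hx]
      rw [ih]
      revert hA
      generalize eps a t s = e
      induction e using WithBot.recBotCoe <;>
        simp only [bot_le, ← WithBot.coe_add, WithBot.coe_le_coe, implies_true]
      omega
    · simp only [eps, h, if_false] at hA
      simp only [sat, h, if_false]
      rw [ih]
      revert hA
      generalize eps a t s = e
      induction e using WithBot.recBotCoe <;>
        simp only [bot_le, ← WithBot.coe_add, WithBot.coe_le_coe, implies_true]
      omega

/-- The parameter matters only through `max 0 (A + e)`, the number of times `ẽ_t` is applied. If A ≠
B, equality of these numbers forces both to be 0, and then neither operator moves the word. -/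
theorem sat_congr {t : L} {A B e : ℤ} {s : List (L × ℤ)} (he : eps a t s = e)
    (h : max 0 (A + e) = max 0 (B + e)) : sat a t A s = sat a t B s := by
  rcases eq_or_ne A B with rfl | hne
  · rfl
  · rw [sat_eq_self, sat_eq_self] <;> rw [he, WithBot.coe_le_coe] <;> omega

theorem eps_sat_of_eq_zero {t u : L} (htu : t ≠ u) (h₁ : a t u = 0) (h₂ : a u t = 0) (A : ℤ)
    (s : List (L × ℤ)) : eps a u (sat a t A s) = eps a u s := by
  induction s generalizing A with
  | nil => rfl
  | cons p s ih =>
    obtain ⟨l, x⟩ := p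
    by_cases h : l = t
    · subst h
      simp [sat, eps, htu, h₂, ih]
    · by_cases h' : l = u
      · subst h'
        simp [sat, eps, htu.symm, ih]
      · simp [sat, eps, h, h', ih]

/-- The tropical Plücker relation. -/
theorem eps_add_eps {t u : L} (htu : t ≠ u) (ht : a t t = 2) (hu : a u u = 2) (h₁ : a t u = -1)
    (h₂ : a u t = -1) (s : List (L × ℤ)) :
    eps a t s + eps a u s = max (mixed a t u s) (mixed a u t s) := by
  induction s with
  | nil => simp [eps, mixed]
  | cons p s ih =>
    obtain ⟨l, x⟩ := p
    revert ih
    by_cases h : l = t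
    · subst h
      simp only [eps, mixed, htu, if_true, if_false, ht, h₂]
      generalize eps a l s = e
      generalize eps a u s = f
      generalize mixed a l u s = m
      generalize mixed a u l s = n
      induction e using WithBot.recBotCoe <;> induction f using WithBot.recBotCoe <;>
        induction m using WithBot.recBotCoe <;> induction n using WithBot.recBotCoe <;>
        simp only [WithBot.bot_add, WithBot.add_bot, bot_sup_eq, sup_bot_eq, ← WithBot.coe_add,
          ← WithBot.coe_max, WithBot.coe_inj, WithBot.bot_ne_coe, WithBot.coe_ne_bot,
          implies_true, false_implies] <;> omega
    · by_cases h' : l = u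
      · subst h'
        simp only [eps, mixed, htu.symm, if_true, if_false, hu, h₁]
        generalize eps a t s = e
        generalize eps a l s = f
        generalize mixed a t l s = m
        generalize mixed a l t s = n
        induction e using WithBot.recBotCoe <;> induction f using WithBot.recBotCoe <;>
          induction m using WithBot.recBotCoe <;> induction n using WithBot.recBotCoe <;>
          simp only [WithBot.bot_add, WithBot.add_bot, bot_sup_eq, sup_bot_eq, ← WithBot.coe_add,
            ← WithBot.coe_max, WithBot.coe_inj, WithBot.bot_ne_coe, WithBot.coe_ne_bot,
            implies_true, false_implies] <;> omega
      · simp only [eps, mixed, h, h', if_false, add_mul]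
        generalize eps a t s = e
        generalize eps a u s = f
        generalize mixed a t u s = m
        generalize mixed a u t s = n
        induction e using WithBot.recBotCoe <;> induction f using WithBot.recBotCoe <;>
          induction m using WithBot.recBotCoe <;> induction n using WithBot.recBotCoe <;>
          simp only [WithBot.bot_add, WithBot.add_bot, bot_sup_eq, sup_bot_eq, ← WithBot.coe_add,
            ← WithBot.coe_max, WithBot.coe_inj, WithBot.bot_ne_coe, WithBot.coe_ne_bot,
            implies_true, false_implies] <;> omega

/-- Across a simple edge the coefficient behind `eps u` is affine in the parameter of x_t; `mixed u
t` is the tropical coefficient of its linear term. -/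
theorem eps_sat_of_adj {t u : L} (htu : t ≠ u) (ht : a t t = 2) (hu : a u u = 2) (h₁ : a t u = -1)
    (h₂ : a u t = -1) (A : ℤ) (s : List (L × ℤ)) :
    eps a u (sat a t A s) = max (eps a u s) (mixed a u t s + (A : WithBot ℤ)) := by
  induction s generalizing A with
  | nil => simp [sat, eps, mixed]
  | cons p s ih =>
    obtain ⟨l, x⟩ := p
    by_cases h : l = t
    · subst h
      simp only [sat, eps, mixed, htu, if_true, if_false, ht, h₂, ih]
      generalize eps a u s = e
      generalize mixed a u l s = m
      induction e using WithBot.recBotCoe <;> induction m using WithBot.recBotCoe <;>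
        simp only [WithBot.bot_add, bot_sup_eq, sup_bot_eq, ← WithBot.coe_add,
          ← WithBot.coe_max, WithBot.coe_inj] <;> omega
    · by_cases h' : l = u
      · subst h'
        simp only [sat, eps, mixed, htu.symm, if_true, if_false, hu, h₁, ih]
        generalize eps a l s = e
        generalize mixed a l t s = m
        induction e using WithBot.recBotCoe <;> induction m using WithBot.recBotCoe <;>
          simp only [WithBot.bot_add, bot_sup_eq, sup_bot_eq, ← WithBot.coe_add,
            ← WithBot.coe_max, WithBot.coe_inj] <;> omega
      · simp only [sat, eps, mixed, h, h', if_false, ih, add_mul]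
        generalize eps a u s = e
        generalize mixed a u t s = m
        induction e using WithBot.recBotCoe <;> induction m using WithBot.recBotCoe <;>
          simp only [WithBot.bot_add, bot_sup_eq, sup_bot_eq, ← WithBot.coe_add,
            ← WithBot.coe_max, WithBot.coe_inj] <;> omega

/-- Like ε_u itself, `mixed u t` is divided by 1 + A ε_u under x_u(A). The equation is stated
additively, since `WithBot ℤ` has no good subtraction. -/
theorem mixed_sat {t u : L} (htu : t ≠ u) (ht : a t t = 2) (hu : a u u = 2) (h₁ : a t u = -1)
    (h₂ : a u t = -1) (A : ℤ) (s : List (L × ℤ)) :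
    mixed a u t (sat a u A s) + max 0 (eps a u s + (A : WithBot ℤ)) = mixed a u t s := by
  rw [← WithBot.coe_zero]
  induction s generalizing A with
  | nil => simp [sat, eps, mixed]
  | cons p s ih =>
    obtain ⟨l, x⟩ := p
    by_cases h : l = t
    · subst h
      simp only [sat, eps, mixed, htu, if_true, if_false, ht, h₂, eps_sat_self]
      have := ih (A - -1 * x)
      revert this
      generalize eps a u s = e
      generalize mixed a u l s = m
      generalize mixed a u l _ = n
      induction e using WithBot.recBotCoe <;> induction m using WithBot.recBotCoe <;>
        induction n using WithBot.recBotCoe <;>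
        simp only [WithBot.bot_add, bot_sup_eq, sup_bot_eq, ← WithBot.coe_add,
          ← WithBot.coe_max, WithBot.coe_inj, bot_inf_eq, ← WithBot.coe_min,
          WithBot.bot_ne_coe, WithBot.coe_ne_bot, implies_true, false_implies] <;> omega
    · by_cases h' : l = u
      · subst h'
        simp only [sat, eps, mixed, htu.symm, if_true, if_false, hu, h₁]
        have := ih (A - x - max x A)
        revert this
        generalize eps a l s = e
        generalize mixed a l t s = m
        generalize mixed a l t _ = n
        induction e using WithBot.recBotCoe <;> induction m using WithBot.recBotCoe <;>
          induction n using WithBot.recBotCoe <;>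
          simp only [WithBot.bot_add, sup_bot_eq, ← WithBot.coe_add,
            ← WithBot.coe_max, WithBot.coe_inj,
            WithBot.bot_ne_coe, WithBot.coe_ne_bot, implies_true, false_implies] <;> omega
      · simp only [sat, eps, mixed, h, h', if_false, add_mul]
        have := ih (A - a u l * x)
        revert this
        generalize eps a u s = e
        generalize mixed a u t s = m
        generalize mixed a u t _ = n
        induction e using WithBot.recBotCoe <;> induction m using WithBot.recBotCoe <;>
          induction n using WithBot.recBotCoe <;>
          simp only [WithBot.bot_add, sup_bot_eq, ← WithBot.coe_add,
            ← WithBot.coe_max, WithBot.coe_inj,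
            WithBot.bot_ne_coe, WithBot.coe_ne_bot, implies_true, false_implies] <;> omega

end LetterWord

/-! ### Powers of the crystal operators on words, and the simply laced braid relation. -/

namespace LetterWord

variable {L : Type*} [DecidableEq L] {a : L → L → ℤ}

variable (a) in
/-- The operator `ẽ_t^c` on words in which the letter `t` occurs. -/
def raise (t : L) (c : ℕ) (s : List (L × ℤ)) : List (L × ℤ) :=
  sat a t (c - (eps a t s).unbotD 0) s

theorem map_fst_raise (t : L) (c : ℕ) (s : List (L × ℤ)) :
    (raise a t c s).map Prod.fst = s.map Prod.fst := map_fst_sat _ _ _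

theorem raise_eq {t : L} {s : List (L × ℤ)} {e : ℤ} (he : eps a t s = e) (c : ℕ) :
    raise a t c s = sat a t (c - e) s := by
  simp [raise, he]

theorem exists_eps {t : L} {s : List (L × ℤ)} (h : t ∈ s.map Prod.fst) :
    ∃ e : ℤ, eps a t s = e :=
  (WithBot.ne_bot_iff_exists.1 (eps_ne_bot h)).imp fun _ h => h.symm

theorem sat_eq_raise {t : L} {A e : ℤ} {s : List (L × ℤ)} {c : ℕ} (he : eps a t s = e)
    (h : max 0 (A + e) = c) : sat a t A s = raise a t c s := by
  rw [raise_eq he]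
  exact sat_congr he (by omega)

theorem eps_raise_self {t : L} {s : List (L × ℤ)} {e : ℤ} (he : eps a t s = e) (c : ℕ) :
    eps a t (raise a t c s) = ((e - c : ℤ) : WithBot ℤ) := by
  rw [raise_eq he, eps_sat_self, he, ← WithBot.coe_min, WithBot.coe_inj]
  omega

theorem raise_zero {t : L} {s : List (L × ℤ)} (h : t ∈ s.map Prod.fst) : raise a t 0 s = s := by
  obtain ⟨e, he⟩ := exists_eps (a := a) h
  rw [raise_eq he, sat_eq_self]
  rw [he, WithBot.coe_le_coe]
  simp

theorem raise_raise_one {t : L} {s : List (L × ℤ)} (h : t ∈ s.map Prod.fst) (c : ℕ) :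
    raise a t 1 (raise a t c s) = raise a t (c + 1) s := by
  obtain ⟨e, he⟩ := exists_eps (a := a) h
  rw [raise_eq (eps_raise_self he c), raise_eq he, raise_eq he, sat_sat_self]
  congr 1
  push_cast
  omega

theorem raise_comm {t u : L} (htu : t ≠ u) (h₁ : a t u = 0) (h₂ : a u t = 0) (c d : ℕ)
    (s : List (L × ℤ)) : raise a t c (raise a u d s) = raise a u d (raise a t c s) := by
  simp only [raise, eps_sat_of_eq_zero htu h₁ h₂, eps_sat_of_eq_zero htu.symm h₂ h₁]
  exact sat_comm htu h₁ h₂ _ _ _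

-- After `sat_braid`, it is enough by `sat_eq_raise` to check that the three new parameters raise by
-- c, c + d and d. The laws for `eps` and `mixed` together with the Plücker relation turn this into
-- integer arithmetic.
set_option maxHeartbeats 1600000 in
theorem raise_braid {t u : L} (htu : t ≠ u) (ht : a t t = 2) (hu : a u u = 2) (h₁ : a t u = -1)
    (h₂ : a u t = -1) {s : List (L × ℤ)} (hts : t ∈ s.map Prod.fst) (hus : u ∈ s.map Prod.fst)
    (c d : ℕ) :
    raise a t c (raise a u (c + d) (raise a t d s)) =
      raise a u d (raise a t (c + d) (raise a u c s)) := by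
  obtain ⟨e, he⟩ := exists_eps (a := a) hts
  obtain ⟨f, hf⟩ := exists_eps (a := a) hus
  have key := eps_add_eps htu ht hu h₁ h₂ s
  rw [raise_eq he]
  set C : ℤ := d - e with hC
  have heC : eps a t (sat a t C s) = ((e - d : ℤ) : WithBot ℤ) := by
    rw [← raise_eq he, eps_raise_self he]
  obtain ⟨f', hf'⟩ := exists_eps (a := a) (s := sat a t C s) (t := u) (by rwa [map_fst_sat])
  rw [raise_eq hf']
  set B : ℤ := (c + d : ℕ) - f' with hB
  obtain ⟨e', he'⟩ := exists_eps (a := a) (s := sat a u B (sat a t C s)) (t := t)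
    (by rwa [map_fst_sat, map_fst_sat])
  rw [raise_eq he']
  set A : ℤ := c - e' with hA
  rw [sat_braid htu h₁ h₂]
  set C' : ℤ := A + B - max A C with hC'
  have hmt := mixed_sat htu.symm hu ht h₂ h₁ C s
  have hmu := mixed_sat htu ht hu h₁ h₂ C' s
  have hf2 := hf'
  rw [eps_sat_of_adj htu ht hu h₁ h₂] at hf2
  have he2 := he'
  rw [eps_sat_of_adj htu.symm hu ht h₂ h₁, heC] at he2
  obtain ⟨e₁, he₁⟩ := exists_eps (a := a) (s := sat a u C' s) (t := t) (by rwa [map_fst_sat])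
  obtain ⟨f₁, hf₁⟩ := exists_eps (a := a) (s := sat a t (max A C) (sat a u C' s)) (t := u)
    (by rwa [map_fst_sat, map_fst_sat])
  have he₂ := he₁
  rw [eps_sat_of_adj htu.symm hu ht h₂ h₁] at he₂
  have hf₂ := hf₁
  rw [eps_sat_of_adj htu ht hu h₁ h₂, eps_sat_self] at hf₂
  have main : max 0 (C' + f) = c ∧ max 0 (max A C + e₁) = (c + d : ℕ) ∧
      max 0 (B + C - max A C + f₁) = d := by
    clear he₁ hf₁ he' hf' heC
    revert key hmt hmu hf2 he2 he₂ hf₂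
    rw [he, hf]
    clear_value C' B A C
    generalize mixed a t u s = m
    generalize mixed a t u _ = m'
    generalize mixed a u t s = n
    generalize mixed a u t _ = n'
    clear he hf
    rw [← WithBot.coe_zero]
    -- The Plücker relation excludes m = n = ⊥, because e + f is finite; `mixed_sat` makes m', n'
    -- infinite exactly when m, n are.
    induction m using WithBot.recBotCoe <;> induction n using WithBot.recBotCoe <;>
      induction m' using WithBot.recBotCoe <;> induction n' using WithBot.recBotCoe <;>
      simp only [WithBot.bot_add, bot_sup_eq, sup_bot_eq, ← WithBot.coe_add,
        ← WithBot.coe_max, ← WithBot.coe_min, WithBot.coe_inj, WithBot.bot_ne_coe,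
        WithBot.coe_ne_bot, implies_true, false_implies]
    all_goals
      intro key hmt hmu hf2 he2 he₂ hf₂
      -- The parameters are identified in the order in which the operators act, innermost first.
      have h₁ : C' = c - f := by
        clear hmu he₂ hf₂
        omega
      have h₂ : max A C = c + d - e₁ := by
        clear hmu hf₂
        omega
      refine ⟨by clear * - h₁; omega, by clear * - h₂; omega, ?_⟩
      clear he₂
      omega
  obtain ⟨m₁, m₂, m₃⟩ := main
  rw [sat_eq_raise hf₁ m₃, sat_eq_raise he₁ m₂, sat_eq_raise hf m₁]

end LetterWord

/-! ### Verma relations in A₃ and D₄ as formal consequences of braid moves. -/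

namespace LetterWord

/-- The Verma relation of type `B₂` follows from the braid relations of its unfolding. -/
theorem verma_of_braid_three {X : Type*} (F : Fin 3 → ℕ → X → X)
    (hc : ∀ p q c d z, p ≠ 0 → q ≠ 0 → p ≠ q → F p c (F q d z) = F q d (F p c z))
    (hb : ∀ p c m d z, p ≠ 0 → m = c + d → F 0 c (F p m (F 0 d z)) = F p d (F 0 m (F p c z)))
    (c d : ℕ) (z : X) :
    F 1 (c) (F 2 (c) (F 0 (2 * c + d) (F 1 (c + d) (F 2 (c + d) (F 0 (d) z))))) =
    F 0 (d) (F 1 (c + d) (F 2 (c + d) (F 0 (2 * c + d) (F 1 (c) (F 2 (c) z))))) := by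
  have hb_symm : ∀ p c m d z, p ≠ 0 → m = c + d →
      F p c (F 0 m (F p d z)) = F 0 d (F p m (F 0 c z)) :=
    fun p c m d z hp hm => (hb p d m c z hp (by omega)).symm
  -- A path of moves between two reduced words of the longest element of A₃, with 0 the central
  -- node. The exponents are the values on the positive coroots of the weight equal to c on each
  -- outer node and d on the centre; in each braid move the middle coroot is the sum of the outer
  -- two, which is the condition `m = c + d`.
  conv_lhs =>
    rw [hc 1 2 (c + d) (c + d) _ (by decide) (by decide) (by decide),
      hb_symm 2 (c) (2 * c + d) (c + d) _ (by decide) (by omega),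
      hb 1 (c) (c + d) (d) _ (by decide) (by omega),
      hc 2 1 (2 * c + d) (d) _ (by decide) (by decide) (by decide),
      hb_symm 1 (c) (c + d) (d) _ (by decide) (by omega),
      hb 2 (c) (2 * c + d) (c + d) _ (by decide) (by omega),
      hc 2 1 (c) (c) _ (by decide) (by decide) (by decide)]

/-- The Verma relation of type `G₂` follows from the braid relations of its unfolding. -/
theorem verma_of_braid_four {X : Type*} (F : Fin 4 → ℕ → X → X)
    (hc : ∀ p q c d z, p ≠ 0 → q ≠ 0 → p ≠ q → F p c (F q d z) = F q d (F p c z))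
    (hb : ∀ p c m d z, p ≠ 0 → m = c + d → F 0 c (F p m (F 0 d z)) = F p d (F 0 m (F p c z)))
    (c d : ℕ) (z : X) :
    F 1 (c) (F 2 (c) (F 3 (c) (F 0 (3 * c + d) (F 1 (2 * c + d) (F 2 (2 * c + d) (F 3 (2 *
      c + d) (F 0 (3 * c + 2 * d) (F 1 (c + d) (F 2 (c + d) (F 3 (c + d) (F 0 (d)
      z))))))))))) =
    F 0 (d) (F 1 (c + d) (F 2 (c + d) (F 3 (c + d) (F 0 (3 * c + 2 * d) (F 1 (2 * c + d)
      (F 2 (2 * c + d) (F 3 (2 * c + d) (F 0 (3 * c + d) (F 1 (c) (F 2 (c) (F 3 (c)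
      z))))))))))) := by
  have hb_symm : ∀ p c m d z, p ≠ 0 → m = c + d →
      F p c (F 0 m (F p d z)) = F 0 d (F p m (F 0 c z)) :=
    fun p c m d z hp hm => (hb p d m c z hp (by omega)).symm
  -- The same in D₄, with twelve positive coroots; 3c + 2d is the value on the highest one, which
  -- contains the centre twice.
  conv_lhs =>
    rw [hc 1 2 (2 * c + d) (2 * c + d) _ (by decide) (by decide) (by decide),
      hc 1 3 (2 * c + d) (2 * c + d) _ (by decide) (by decide) (by decide),
      hc 2 3 (2 * c + d) (2 * c + d) _ (by decide) (by decide) (by decide),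
      hb_symm 3 (c) (3 * c + d) (2 * c + d) _ (by decide) (by omega),
      hb_symm 1 (2 * c + d) (3 * c + 2 * d) (c + d) _ (by decide) (by omega),
      hb 2 (c) (2 * c + d) (c + d) _ (by decide) (by omega),
      hc 3 2 (3 * c + d) (c + d) _ (by decide) (by decide) (by decide),
      hc 2 1 (c) (3 * c + 2 * d) _ (by decide) (by decide) (by decide),
      hb_symm 2 (c) (2 * c + d) (c + d) _ (by decide) (by omega),
      hb 3 (c) (3 * c + d) (2 * c + d) _ (by decide) (by omega),
      hc 3 1 (c) (3 * c + 2 * d) _ (by decide) (by decide) (by decide),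
      hb_symm 2 (c) (2 * c + d) (c + d) _ (by decide) (by omega),
      hb 3 (c) (c + d) (d) _ (by decide) (by omega),
      hc 2 3 (2 * c + d) (d) _ (by decide) (by decide) (by decide),
      hb_symm 3 (c) (c + d) (d) _ (by decide) (by omega),
      hb 1 (3 * c + d) (3 * c + 2 * d) (d) _ (by decide) (by omega),
      hc 3 1 (2 * c + d) (d) _ (by decide) (by decide) (by decide),
      hc 2 1 (2 * c + d) (d) _ (by decide) (by decide) (by decide),
      hc 1 3 (3 * c + d) (c + d) _ (by decide) (by decide) (by decide),
      hb 2 (c) (2 * c + d) (c + d) _ (by decide) (by omega),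
      hc 1 2 (3 * c + d) (c + d) _ (by decide) (by decide) (by decide),
      hb_symm 1 (c) (c + d) (d) _ (by decide) (by omega),
      hb_symm 3 (2 * c + d) (3 * c + 2 * d) (c + d) _ (by decide) (by omega),
      hb 2 (c) (2 * c + d) (c + d) _ (by decide) (by omega),
      hc 2 3 (c) (3 * c + 2 * d) _ (by decide) (by decide) (by decide),
      hb_symm 2 (c) (2 * c + d) (c + d) _ (by decide) (by omega),
      hb 1 (c) (3 * c + d) (2 * c + d) _ (by decide) (by omega),
      hc 2 1 (2 * c + d) (2 * c + d) _ (by decide) (by decide) (by decide),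
      hb 3 (2 * c + d) (3 * c + 2 * d) (c + d) _ (by decide) (by omega),
      hc 3 1 (2 * c + d) (2 * c + d) _ (by decide) (by decide) (by decide),
      hc 3 2 (2 * c + d) (2 * c + d) _ (by decide) (by decide) (by decide)]

/-! ### Unfolding B₂ to A₃ and G₂ to D₄. -/

section RaiseOn

variable {L ι : Type*} [DecidableEq L]

/-- The words in which all the letters `node p` occur. -/
def WordsWith (node : ι → L) : Type _ := {s : List (L × ℤ) // ∀ p, node p ∈ s.map Prod.fst}

/-- `raise` on words in which all the letters `node p` occur. -/
def raiseOn (a : L → L → ℤ) (node : ι → L) (p : ι) (c : ℕ) (s : WordsWith node) :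
    WordsWith node :=
  ⟨raise a (node p) c s.1, fun q => by rw [map_fst_raise]; exact s.2 q⟩

end RaiseOn

section Fold

variable {I : Type*} [DecidableEq I] (a : I → I → ℤ) (i j : I)

/-- Replace every letter `i` by its copies indexed by `ks`. -/
def fold (ks : List (Fin 3)) : List (I × ℤ) → List ((I × Fin 3) × ℤ)
  | [] => []
  | (l, x) :: s => (if l = i then ks.map fun k => ((i, k), x) else [((l, 0), x)]) ++ fold ks s

/-- The pairings after unfolding the node `i` into copies which are joined to the other nodes by
simple edges. -/
def foldPairing (p q : I × Fin 3) : ℤ :=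
  if q.1 = i then if p.1 = i then if p.2 = q.2 then 2 else 0 else -1 else a p.1 q.1

/-- A left inverse of `fold`. -/
def unfold (s : List ((I × Fin 3) × ℤ)) : List (I × ℤ) :=
  s.filterMap fun p => if p.1.2 = 0 then some (p.1.1, p.2) else none

variable {a i j}

theorem unfold_fold_two (s : List (I × ℤ)) : unfold (fold i [0, 1] s) = s := by
  induction s with
  | nil => rfl
  | cons p s ih =>
    obtain ⟨l, x⟩ := p
    unfold unfold at ih
    by_cases h : l = i <;> simp [fold, unfold, h, ih]

theorem unfold_fold_three (s : List (I × ℤ)) : unfold (fold i [0, 1, 2] s) = s := by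
  induction s with
  | nil => rfl
  | cons p s ih =>
    obtain ⟨l, x⟩ := p
    unfold unfold at ih
    by_cases h : l = i <;> simp [fold, unfold, h, ih]

theorem mem_fold_self {ks : List (Fin 3)} {k : Fin 3} (hk : k ∈ ks) {s : List (I × ℤ)}
    (hs : i ∈ s.map Prod.fst) : (i, k) ∈ (fold i ks s).map Prod.fst := by
  induction s with
  | nil => simp at hs
  | cons p s ih =>
    obtain ⟨l, x⟩ := p
    by_cases h : l = i
    · simp [fold, h, hk]
    · have := ih (by simpa [Ne.symm h] using hs)
      rw [fold, List.map_append]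
      exact List.mem_append_right _ this

theorem mem_fold_of_ne {ks : List (Fin 3)} (hij : j ≠ i) {s : List (I × ℤ)}
    (hs : j ∈ s.map Prod.fst) : (j, 0) ∈ (fold i ks s).map Prod.fst := by
  induction s with
  | nil => simp at hs
  | cons p s ih =>
    obtain ⟨l, x⟩ := p
    rw [fold, List.map_append]
    by_cases h : l = j
    · subst h
      simp [hij]
    · exact List.mem_append_right _ (ih (by simpa [Ne.symm h] using hs))

/-- Crossing two copies with pairing -1 each has the effect of crossing one letter i with pairing
-2. The rows of `foldPairing` at other nodes play no role, since only operators at j and at copies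
of i are applied. -/
theorem fold_sat_of_ne_two (hij : j ≠ i) (hji : a j i = -2) (A : ℤ) (s : List (I × ℤ)) :
    fold i [0, 1] (sat a j A s) = sat (foldPairing a i) (j, 0) A (fold i [0, 1] s) := by
  induction s generalizing A with
  | nil => rfl
  | cons p s ih =>
    obtain ⟨l, x⟩ := p
    by_cases h : l = i
    · subst h
      simp [fold, sat, foldPairing, hij, hij.symm, hji, ih]
      congr 1; omega
    · by_cases h' : l = j
      · subst h'
        simp [fold, sat, h, ih]
      · simp [fold, sat, foldPairing, h, h', ih]

theorem fold_sat_of_ne_three (hij : j ≠ i) (hji : a j i = -3) (A : ℤ) (s : List (I × ℤ)) :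
    fold i [0, 1, 2] (sat a j A s) = sat (foldPairing a i) (j, 0) A (fold i [0, 1, 2] s) := by
  induction s generalizing A with
  | nil => rfl
  | cons p s ih =>
    obtain ⟨l, x⟩ := p
    by_cases h : l = i
    · subst h
      simp [fold, sat, foldPairing, hij, hij.symm, hji, ih]
      congr 1; omega
    · by_cases h' : l = j
      · subst h'
        simp [fold, sat, h, ih]
      · simp [fold, sat, foldPairing, h, h', ih]

/-- The copies are orthogonal, so each operator sees exactly one letter of every block, and the
blocks stay constant once both have acted. -/
theorem fold_sat_self_two (A : ℤ) (s : List (I × ℤ)) :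
    fold i [0, 1] (sat a i A s) =
      sat (foldPairing a i) (i, 0) A (sat (foldPairing a i) (i, 1) A (fold i [0, 1] s)) := by
  induction s generalizing A with
  | nil => rfl
  | cons p s ih =>
    obtain ⟨l, x⟩ := p
    by_cases h : l = i
    · subst h
      simp [fold, sat, foldPairing, ih]
    · simp [fold, sat, foldPairing, h, ih]

theorem fold_sat_self_three (A : ℤ) (s : List (I × ℤ)) :
    fold i [0, 1, 2] (sat a i A s) =
      sat (foldPairing a i) (i, 0) A (sat (foldPairing a i) (i, 1) A
        (sat (foldPairing a i) (i, 2) A (fold i [0, 1, 2] s))) := by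
  induction s generalizing A with
  | nil => rfl
  | cons p s ih =>
    obtain ⟨l, x⟩ := p
    by_cases h : l = i
    · subst h
      simp [fold, sat, foldPairing, ih]
    · simp [fold, sat, foldPairing, h, ih]

theorem eps_fold_of_ne_two (hij : j ≠ i) (hji : a j i = -2) (s : List (I × ℤ)) :
    eps (foldPairing a i) (j, 0) (fold i [0, 1] s) = eps a j s := by
  induction s with
  | nil => rfl
  | cons p s ih =>
    obtain ⟨l, x⟩ := p
    by_cases h : l = i
    · subst h
      simp [fold, eps, foldPairing, hij, hij.symm, hji, ih, add_assoc, two_mul]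
    · by_cases h' : l = j
      · subst h'
        simp [fold, eps, h, ih]
      · simp [fold, eps, foldPairing, h, h', ih]

theorem eps_fold_of_ne_three (hij : j ≠ i) (hji : a j i = -3) (s : List (I × ℤ)) :
    eps (foldPairing a i) (j, 0) (fold i [0, 1, 2] s) = eps a j s := by
  induction s with
  | nil => rfl
  | cons p s ih =>
    obtain ⟨l, x⟩ := p
    by_cases h : l = i
    · subst h
      have : 3 * x = x + (x + x) := by ring
      simp [fold, eps, foldPairing, hij, hij.symm, hji, ih, add_assoc, this]
    · by_cases h' : l = j
      · subst h'
        simp [fold, eps, h, ih]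
      · simp [fold, eps, foldPairing, h, h', ih]

theorem eps_fold_self_two {k : Fin 3} (hk : k ∈ [0, 1]) (s : List (I × ℤ)) :
    eps (foldPairing a i) (i, k) (fold i [0, 1] s) = eps a i s := by
  induction s with
  | nil => rfl
  | cons p s ih =>
    obtain ⟨l, x⟩ := p
    by_cases h : l = i
    · subst h
      simp only [List.mem_cons, List.not_mem_nil, or_false] at hk
      rcases hk with rfl | rfl <;> simp [fold, eps, foldPairing, ih]
    · simp [fold, eps, foldPairing, h, ih]

theorem eps_fold_self_three (k : Fin 3) (s : List (I × ℤ)) :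
    eps (foldPairing a i) (i, k) (fold i [0, 1, 2] s) = eps a i s := by
  induction s with
  | nil => rfl
  | cons p s ih =>
    obtain ⟨l, x⟩ := p
    by_cases h : l = i
    · subst h
      fin_cases k <;> simp [fold, eps, foldPairing] at ih ⊢ <;> simp [ih]
    · simp [fold, eps, foldPairing, h, ih]

theorem foldPairing_self_ne {k k' : Fin 3} (h : k ≠ k') :
    foldPairing a i (i, k) (i, k') = 0 := by
  simp [foldPairing, h]

theorem fold_raise_of_ne_two (hij : j ≠ i) (hji : a j i = -2) (c : ℕ) (s : List (I × ℤ)) :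
    fold i [0, 1] (raise a j c s) = raise (foldPairing a i) (j, 0) c (fold i [0, 1] s) := by
  rw [raise, raise, eps_fold_of_ne_two hij hji, fold_sat_of_ne_two hij hji]

theorem fold_raise_of_ne_three (hij : j ≠ i) (hji : a j i = -3) (c : ℕ) (s : List (I × ℤ)) :
    fold i [0, 1, 2] (raise a j c s) = raise (foldPairing a i) (j, 0) c (fold i [0, 1, 2] s) := by
  rw [raise, raise, eps_fold_of_ne_three hij hji, fold_sat_of_ne_three hij hji]

theorem fold_raise_self_two (c : ℕ) (s : List (I × ℤ)) :
    fold i [0, 1] (raise a i c s) = raise (foldPairing a i) (i, 0) c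
      (raise (foldPairing a i) (i, 1) c (fold i [0, 1] s)) := by
  simp only [raise]
  rw [eps_sat_of_eq_zero (by simp) (foldPairing_self_ne (by decide))
    (foldPairing_self_ne (by decide)), eps_fold_self_two (by simp), eps_fold_self_two (by simp),
    fold_sat_self_two]

theorem fold_raise_self_three (c : ℕ) (s : List (I × ℤ)) :
    fold i [0, 1, 2] (raise a i c s) = raise (foldPairing a i) (i, 0) c
      (raise (foldPairing a i) (i, 1) c
        (raise (foldPairing a i) (i, 2) c (fold i [0, 1, 2] s))) := by
  simp only [raise]
  rw [eps_sat_of_eq_zero (t := (i, 1)) (u := (i, 0)), eps_sat_of_eq_zero (t := (i, 2)) (u := (i, 0)),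
    eps_sat_of_eq_zero (t := (i, 2)) (u := (i, 1)), eps_fold_self_three, eps_fold_self_three,
    eps_fold_self_three, fold_sat_self_three] <;>
  simp [foldPairing]

theorem raise_verma_two (hij : j ≠ i) (hjj : a j j = 2) (h₁ : a i j = -1) (h₂ : a j i = -2)
    {s : List (I × ℤ)} (hi : i ∈ s.map Prod.fst) (hj : j ∈ s.map Prod.fst) (c d : ℕ) :
    raise a i c (raise a j (2 * c + d) (raise a i (c + d) (raise a j d s))) =
      raise a j d (raise a i (c + d) (raise a j (2 * c + d) (raise a i c s))) := by
  -- `unfold` makes `fold` injective, so the identity may be checked after unfolding.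
  refine Function.LeftInverse.injective (unfold_fold_two (i := i)) ?_
  simp only [fold_raise_self_two, fold_raise_of_ne_two hij h₂]
  let node : Fin 3 → I × Fin 3 := ![(j, 0), (i, 0), (i, 1)]
  have hnode : ∀ p, node p ∈ (fold i [0, 1] s).map Prod.fst := by
    intro p
    fin_cases p
    · exact mem_fold_of_ne hij hj
    all_goals exact mem_fold_self (by simp) hi
  -- `raise_braid` needs both letters to occur, so the operators are restricted to `WordsWith node`,
  -- which they preserve.
  have := verma_of_braid_three (raiseOn (foldPairing a i) node)
    (by
      intro p q c d z hp hq hpq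
      refine Subtype.ext (raise_comm ?_ ?_ ?_ c d _) <;>
      fin_cases p <;> fin_cases q <;> simp [node, foldPairing] at hp hq hpq ⊢)
    (by
      intro p c m d z hp hm
      subst hm
      refine Subtype.ext (raise_braid ?_ ?_ ?_ ?_ ?_ (z.2 _) (z.2 _) c d) <;>
      fin_cases p <;> simp [node, foldPairing, hij, h₁, hjj] at hp ⊢)
    c d ⟨_, hnode⟩
  exact congrArg Subtype.val this

theorem raise_verma_three (hij : j ≠ i) (hjj : a j j = 2) (h₁ : a i j = -1) (h₂ : a j i = -3)
    {s : List (I × ℤ)} (hi : i ∈ s.map Prod.fst) (hj : j ∈ s.map Prod.fst) (c d : ℕ) :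
    raise a i c (raise a j (3 * c + d) (raise a i (2 * c + d) (raise a j (3 * c + 2 * d)
        (raise a i (c + d) (raise a j d s))))) =
      raise a j d (raise a i (c + d) (raise a j (3 * c + 2 * d) (raise a i (2 * c + d)
        (raise a j (3 * c + d) (raise a i c s))))) := by
  refine Function.LeftInverse.injective (unfold_fold_three (i := i)) ?_
  simp only [fold_raise_self_three, fold_raise_of_ne_three hij h₂]
  let node : Fin 4 → I × Fin 3 := ![(j, 0), (i, 0), (i, 1), (i, 2)]
  have hnode : ∀ p, node p ∈ (fold i [0, 1, 2] s).map Prod.fst := by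
    intro p
    fin_cases p
    · exact mem_fold_of_ne hij hj
    all_goals exact mem_fold_self (by simp) hi
  have := verma_of_braid_four (raiseOn (foldPairing a i) node)
    (by
      intro p q c d z hp hq hpq
      refine Subtype.ext (raise_comm ?_ ?_ ?_ c d _) <;>
      fin_cases p <;> fin_cases q <;> simp [node, foldPairing] at hp hq hpq ⊢)
    (by
      intro p c m d z hp hm
      subst hm
      refine Subtype.ext (raise_braid ?_ ?_ ?_ ?_ ?_ (z.2 _) (z.2 _) c d) <;>
      fin_cases p <;> simp [node, foldPairing, hij, h₁, hjj] at hp ⊢)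
    c d ⟨_, hnode⟩
  exact congrArg Subtype.val this

end Fold

end LetterWord

namespace CartanDatum

variable {I P : Type*} [AddCommGroup P] (D : CartanDatum I P)

/-- The entries of the Cartan matrix as a function of two nodes. -/
def pairing (i j : I) : ℤ := D.A i j

theorem pairing_self (i : I) : D.pairing i i = 2 := D.diag i

theorem coroot_root_eq (i j : I) : D.coroot i (D.root j) = D.pairing i j := D.coroot_root i j

end CartanDatum

/-! ### Encoding tensor products of elementary crystals by words. -/

namespace Crystal

open LetterWord

variable {I P : Type*} [AddCommGroup P] {D : CartanDatum I P}

theorem ePow_zero (B : Crystal D) (i : I) : B.ePow i 0 = id := rfl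

theorem ePow_none (B : Crystal D) (i : I) (c : ℕ) : B.ePow i c none = none :=
  Function.iterate_fixed rfl c

variable [DecidableEq I]

/-- An embedding of a crystal into the words with letters `w`, compatible with all `ε_l`, `ẽ_l`. -/
structure WordModel (B : Crystal D) (w : List I) where
  enc : B.carrier → List (I × ℤ)
  injective : Function.Injective enc
  map_fst : ∀ b, (enc b).map Prod.fst = w
  ε_eq : ∀ l b, B.ε l b = eps D.pairing l (enc b)
  e_eq : ∀ l b, l ∈ w → ∃ b', B.e l b = some b' ∧ enc b' = raise D.pairing l 1 (enc b)

theorem WordModel.e_eq_none {B : Crystal D} {w : List I} (M : WordModel B w) {l : I} (hl : l ∉ w)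
    (b : B.carrier) : B.e l b = none := by
  apply B.e_eq_none
  rw [B.φ_eq, M.ε_eq, eps_eq_bot, WithBot.bot_add]
  rwa [M.map_fst]

/-- The word model of an elementary crystal. -/
def WordModel.elementary (D : CartanDatum I P) (i : I) :
    WordModel (Crystal.elementary D i) [i] where
  enc := fun x : ℤ => [(i, x)]
  injective _ _ h := (Prod.mk.inj (List.cons.inj h).1).2
  map_fst _ := rfl
  ε_eq l x := by
    change ℤ at x
    by_cases h : l = i
    · simp [Crystal.elementary, eps, h]
    · simp [Crystal.elementary, eps, h, Ne.symm h]
  e_eq l x hl := by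
    rw [List.mem_singleton] at hl
    subst hl
    change ℤ at x
    refine ⟨(x + 1 : ℤ), by simp [Crystal.elementary], ?_⟩
    simp only [raise, eps, if_true, sat, WithBot.bot_add, sup_bot_eq, WithBot.unbotD_coe]
    congr 2
    omega

/-- The word model of the tensor product of an elementary crystal with a crystal of words. -/
def WordModel.cons {B : Crystal D} {w : List I} (M : WordModel B w) (i : I) :
    WordModel (tensor (Crystal.elementary D i) B) (i :: w) where
  enc b := (i, (b.1 : ℤ)) :: M.enc b.2
  injective := by
    rintro ⟨x, b⟩ ⟨y, c⟩ h
    exact Prod.ext (Prod.mk.inj (List.cons.inj h).1).2 (M.injective (List.cons.inj h).2)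
  map_fst b := by rw [List.map_cons, M.map_fst]
  ε_eq l b := by
    obtain ⟨x, b⟩ := b
    change ℤ at x
    by_cases h : l = i
    · subst h
      simp [tensor, Crystal.elementary, eps, M.ε_eq, D.coroot_root_eq, D.pairing_self, mul_comm]
    · simp [tensor, Crystal.elementary, eps, M.ε_eq, D.coroot_root_eq, h, Ne.symm h, mul_comm]
  e_eq l b hl := by
    obtain ⟨x, b⟩ := b
    change ℤ at x
    by_cases h : l = i
    · subst h
      -- This is the tensor product rule, as φ of the first factor is x. If it holds, the first
      -- integer becomes x + 1 and the parameter left for the tail is -x, too small to move it;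
      -- otherwise the first integer stays and the tail receives 1 - e, that is, one application of
      -- `ẽ_l`.
      by_cases hc : eps D.pairing l (M.enc b) ≤ (x : WithBot ℤ)
      · refine ⟨((x + 1 : ℤ), b), by simp [tensor, Crystal.elementary, M.ε_eq, hc], ?_⟩
        have he : eps D.pairing l ((l, x) :: M.enc b) = ((-x : ℤ) : WithBot ℤ) := by
          rw [eps, if_pos rfl, max_eq_left]
          revert hc
          generalize eps D.pairing l (M.enc b) = e
          induction e using WithBot.recBotCoe <;>
            simp only [WithBot.bot_add, bot_le, ← WithBot.coe_add, WithBot.coe_le_coe,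
              implies_true]
          omega
        change (l, (x + 1 : ℤ)) :: M.enc b = raise D.pairing l 1 ((l, x) :: M.enc b)
        rw [raise_eq he, sat, if_pos rfl, sat_eq_self]
        · congr 2
          omega
        · refine hc.trans (WithBot.coe_le_coe.2 ?_)
          omega
      · have hne : eps D.pairing l (M.enc b) ≠ ⊥ := fun h => hc (h ▸ bot_le)
        have hlw : l ∈ w := by
          by_contra hlw
          exact hne (eps_eq_bot (by rwa [M.map_fst]))
        obtain ⟨b', hb', hM⟩ := M.e_eq l b hlw
        refine ⟨(x, b'), by simp [tensor, Crystal.elementary, M.ε_eq, hc, hb'], ?_⟩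
        change (l, x) :: M.enc b' = raise D.pairing l 1 ((l, x) :: M.enc b)
        obtain ⟨e, he⟩ := WithBot.ne_bot_iff_exists.1 hne
        rw [← he, WithBot.coe_le_coe] at hc
        have he' : eps D.pairing l ((l, x) :: M.enc b) = ((e - 2 * x : ℤ) : WithBot ℤ) := by
          rw [eps, if_pos rfl, ← he, ← WithBot.coe_add, ← WithBot.coe_max, WithBot.coe_inj]
          omega
        rw [hM, raise_eq he', raise_eq he.symm, sat, if_pos rfl]
        congr 2 <;> omega
    · have hlw : l ∈ w := (List.mem_cons.1 hl).resolve_left h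
      obtain ⟨b', hb', hM⟩ := M.e_eq l b hlw
      have hne : eps D.pairing l (M.enc b) ≠ ⊥ := eps_ne_bot (by rwa [M.map_fst])
      refine ⟨(x, b'), by simp [tensor, Crystal.elementary, M.ε_eq, hne, hb', h], ?_⟩
      change (i, x) :: M.enc b' = raise D.pairing l 1 ((i, x) :: M.enc b)
      obtain ⟨e, he⟩ := WithBot.ne_bot_iff_exists.1 hne
      have he' : eps D.pairing l ((i, x) :: M.enc b) = ((e - D.pairing l i * x : ℤ) : WithBot ℤ) := by
        rw [eps, if_neg (Ne.symm h), ← he, ← WithBot.coe_add, sub_eq_add_neg]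
      rw [hM, raise_eq he', raise_eq he.symm, sat, if_neg (Ne.symm h)]
      congr 2
      omega

theorem nonempty_wordModel (D : CartanDatum I P) (i : I) (w : List I) :
    Nonempty (WordModel (elementaryTensor D i w) (i :: w)) := by
  induction w generalizing i with
  | nil => exact ⟨WordModel.elementary D i⟩
  | cons j w ih => exact (ih j).map fun M => M.cons i

theorem WordModel.map_ePow {B : Crystal D} {w : List I} (M : WordModel B w) {l : I} (hl : l ∈ w)
    (c : ℕ) (b : Option B.carrier) :
    (B.ePow l c b).map M.enc = (b.map M.enc).map (raise D.pairing l c) := by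
  cases b with
  | none => rw [ePow_none]; rfl
  | some b =>
    have hb : ∀ b, l ∈ (M.enc b).map Prod.fst := fun b => by rwa [M.map_fst]
    induction c with
    | zero => simp [ePow, raise_zero (hb b)]
    | succ c ih =>
      rw [ePow, Function.iterate_succ_apply', ← ePow]
      cases h : B.ePow l c (some b) with
      | none => simp [h] at ih
      | some b₁ =>
        rw [h] at ih
        simp only [Option.map_some, Option.some.injEq] at ih
        obtain ⟨b₂, h₂, hM⟩ := M.e_eq l b₁ hl
        simp [h₂, hM, ih, raise_raise_one (hb b)]

theorem WordModel.ePow_succ_eq_none {B : Crystal D} {w : List I} (M : WordModel B w) {l : I}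
    (hl : l ∉ w) (c : ℕ) (b : Option B.carrier) : B.ePow l (c + 1) b = none := by
  rw [ePow, Function.iterate_succ_apply, ← ePow]
  cases b <;> simp [M.e_eq_none hl, ePow_none]

/-- Identities between the operators `ẽ_l^c` may be checked on words. -/
theorem WordModel.eq_of_map_eq {B : Crystal D} {w : List I} (M : WordModel B w)
    {F G : Option B.carrier → Option B.carrier} {f g : List (I × ℤ) → List (I × ℤ)}
    (hF : ∀ b, (F b).map M.enc = (b.map M.enc).map f)
    (hG : ∀ b, (G b).map M.enc = (b.map M.enc).map g)
    (h : ∀ s : List (I × ℤ), s.map Prod.fst = w → f s = g s) : F = G := by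
  funext b
  apply Option.map_injective M.injective
  rw [hF, hG]
  cases b with
  | none => rfl
  | some b => simp [h _ (M.map_fst b)]

end Crystal

/-! ### Degenerate cases and conclusion. -/

open Crystal LetterWord in
theorem corollary5p8 {I P : Type*} [Finite I] [DecidableEq I] [AddCommGroup P]
    (D : CartanDatum I P) (i₁ : I) (w : List I)
    (B : Crystal D) (hB : B = Crystal.elementaryTensor D i₁ w) (i j : I) (c₁ c₂ : ℕ) :
    (D.coroot i (D.root j) = 0 →
      B.ePow i c₁ ∘ B.ePow j c₂ = B.ePow j c₂ ∘ B.ePow i c₁) ∧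
    (D.coroot i (D.root j) = -1 → D.coroot j (D.root i) = -1 →
      B.ePow i c₁ ∘ B.ePow j (c₁ + c₂) ∘ B.ePow i c₂ =
        B.ePow j c₂ ∘ B.ePow i (c₁ + c₂) ∘ B.ePow j c₁) ∧
    (D.coroot i (D.root j) = -1 → D.coroot j (D.root i) = -2 →
      B.ePow i c₁ ∘ B.ePow j (2 * c₁ + c₂) ∘ B.ePow i (c₁ + c₂) ∘ B.ePow j c₂ =
        B.ePow j c₂ ∘ B.ePow i (c₁ + c₂) ∘ B.ePow j (2 * c₁ + c₂) ∘ B.ePow i c₁) ∧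
    (D.coroot i (D.root j) = -1 → D.coroot j (D.root i) = -3 →
      B.ePow i c₁ ∘ B.ePow j (3 * c₁ + c₂) ∘ B.ePow i (2 * c₁ + c₂) ∘
          B.ePow j (3 * c₁ + 2 * c₂) ∘ B.ePow i (c₁ + c₂) ∘ B.ePow j c₂ =
        B.ePow j c₂ ∘ B.ePow i (c₁ + c₂) ∘ B.ePow j (3 * c₁ + 2 * c₂) ∘
          B.ePow i (2 * c₁ + c₂) ∘ B.ePow j (3 * c₁ + c₂) ∘ B.ePow i c₁) := by
  obtain ⟨M⟩ : Nonempty (WordModel B (i₁ :: w)) := hB ▸ nonempty_wordModel D i₁ w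
  clear hB
  simp only [D.coroot_root_eq]
  have hne : D.pairing i j ≠ 2 → j ≠ i := by
    rintro h rfl
    exact h (D.pairing_self _)
  -- If c₁ or c₂ vanishes, both sides coincide once identity factors are dropped. Otherwise every
  -- exponent is positive, so if i or j is missing from the word both sides are constantly 0.
  rcases Nat.eq_zero_or_pos c₁ with rfl | hc₁
  · simp [ePow_zero]
  rcases Nat.eq_zero_or_pos c₂ with rfl | hc₂
  · simp [ePow_zero]
  have hnone : ∀ l, l ∉ i₁ :: w → ∀ c, 0 < c → B.ePow l c = fun _ => none := by
    intro l hl c hc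
    obtain ⟨c, rfl⟩ := Nat.exists_eq_succ_of_ne_zero hc.ne'
    exact funext (M.ePow_succ_eq_none hl c)
  by_cases hi : i ∈ i₁ :: w
  swap
  · have := hnone i hi
    simp +contextual [funext_iff, ePow_none, this, hc₁, hc₂]
  by_cases hj : j ∈ i₁ :: w
  swap
  · have := hnone j hj
    simp +contextual [funext_iff, ePow_none, this, hc₁, hc₂]
  refine ⟨fun h => ?_, fun h₁ h₂ => ?_, fun h₁ h₂ => ?_, fun h₁ h₂ => ?_⟩
  · have hij : j ≠ i := hne (by omega)
    refine M.eq_of_map_eq (f := raise D.pairing i c₁ ∘ raise D.pairing j c₂)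
      (g := raise D.pairing j c₂ ∘ raise D.pairing i c₁) (fun b => ?_) (fun b => ?_) fun s hs => ?_
    · simp [M.map_ePow, hi, hj, Function.comp_def]
    · simp [M.map_ePow, hi, hj, Function.comp_def]
    · exact raise_comm hij.symm h ((D.zero_iff i j).1 h) c₁ c₂ s
  all_goals
    have hij : j ≠ i := hne (by omega)
  · refine M.eq_of_map_eq (fun b => ?_) (fun b => ?_) fun s hs =>
      raise_braid hij.symm (D.pairing_self i) (D.pairing_self j) h₁ h₂ (hs ▸ hi) (hs ▸ hj) c₁ c₂ <;>
    simp [M.map_ePow, hi, hj, Function.comp_def]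
  · refine M.eq_of_map_eq (fun b => ?_) (fun b => ?_) fun s hs =>
      raise_verma_two hij (D.pairing_self j) h₁ h₂ (hs ▸ hi) (hs ▸ hj) c₁ c₂ <;>
    simp [M.map_ePow, hi, hj, Function.comp_def]
  · refine M.eq_of_map_eq (fun b => ?_) (fun b => ?_) fun s hs =>
      raise_verma_three hij (D.pairing_self j) h₁ h₂ (hs ▸ hi) (hs ▸ hj) c₁ c₂ <;>
    simp [M.map_ePow, hi, hj, Function.comp_def]
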